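/- **Model.** $n$ asynchronous processes communicate through swap objects; the only operation, $\mathrm{Swap}(w)$, stores $w$ in an object and returns its previous value. A configuration consists of a state for every process and a value for every object. In a step, a process that has not decided applies the swap it is poised to apply and then updates its state by local computation. A $k$-set agreement algorithm with inputs in $\{0,\dots,m-1\}$ ($m$-valued) must satisfy, in every execution from an initial configuration, *$k$-agreement* (at most $k$ values are decided) and *validity* (every decided value is the input of some process). It is *nondeterministic solo-terminating* if from every reachable configuration every process $p$ has an execution with steps by $p$ only that ends with $p$ having decided; it is *obstruction-free* if moreover it is deterministic. **Algorithm.** Let $n>k\ge 1$ and $m\ge 1$. There are $n-k$ swap objects $B_1,\dots,B_{n-k}$, each holding a pair (lap counter in $\mathbb N^m$, identifier), initially $\langle(0,\dots,0),\bot\rangle$. A process $p$ with input $v$ sets $U\leftarrow(0,\dots,0)$, $U[v]\leftarrow 1$, and then repeats the following loop. It sets $\mathit{conflict}\leftarrow$ false. For $i=1,\dots,n-k$ it performs $\langle U',p'\rangle\leftarrow \mathrm{Swap}(B_i,\langle U,p\rangle)$; if $\langle U',p'\rangle\ne\langle U,p\rangle$, it sets $\mathit{conflict}\leftarrow$ true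 and replaces $U$ by the componentwise maximum of $U$ and $U'$. After these swaps, if $\mathit{conflict}$ is false, it lets $x$ be the least index with $U[x]=\max_j U[j]$; if $U[x]\ge U[j]+2$ for all $j\ne x$, it decides $x$ and stops; otherwise it sets $U[x]\leftarrow U[x]+1$. **Theorem.** For all $n>k\ge 1$ and $m\ge 1$, this algorithm is an $n$-process, $m$-valued, obstruction-free $k$-set agreement algorithm using $n-k$ swap objects: it satisfies $k$-agreement and validity and is obstruction-free. Moreover, for every configuration $C$ and every process $p$, every execution from $C$ with steps by $p$ only contains at most $8(n-k)$ steps. For $k=1$ and $m\ge 2$ the number $n-1$ of objects is optimal: every $n$-process, $m$-valued, nondeterministic solo-terminating (in particular every obstruction-free) consensus (that is, $1$-set agreement) algorithm from swap objects uses at least $n-1$ objects. -/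

import Mathlib

universe u v

/-- What a process does next in a given local state: it has decided the value `x`, or it is poised
to apply `Swap(w)` to the object `B`. There is no other operation (in particular no `Read`). -/
inductive SwapAction (m b : ℕ) (Val : Type u) : Type u where
  | decided (x : Fin m) : SwapAction m b Val
  | swap (B : Fin b) (w : Val) : SwapAction m b Val

/-- An asynchronous, possibly nondeterministic, shared-memory algorithm for `n` processes with
inputs in `{0, …, m - 1}`, using exactly `b` swap objects with values in `Val`. -/
structure SwapAlgorithm (n m b : ℕ) where
  /-- the values that a swap object can store -/
  Val : Type u
  /-- the local states of processes -/
  State : Type v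
  /-- the initial values of the objects -/
  initVal : Fin b → Val
  /-- the initial state of process `p` with input `x` -/
  initState : Fin n → Fin m → State
  /-- what process `p` does in a given state -/
  action : Fin n → State → SwapAction m b Val
  /-- `next p s r`: the possible states of process `p` after its pending operation in state `s`
  returned the response `r` and its local computation is finished -/
  next : Fin n → State → Val → Set State
  /-- the local computation of a process that has not decided has an outcome -/
  next_nonempty : ∀ p s B w, action p s = SwapAction.swap B w → ∀ r, (next p s r).Nonempty

namespace SwapAlgorithm

variable {n m b : ℕ}

/-- A configuration: a state for every process and a value for every object. -/
structure Config (A : SwapAlgorithm.{u, v} n m b) where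
  state : Fin n → A.State
  val : Fin b → A.Val

/-- The initial configuration in which process `p` has input `input p`. -/
def initConfig (A : SwapAlgorithm.{u, v} n m b) (input : Fin n → Fin m) : A.Config where
  state := fun p => A.initState p (input p)
  val := A.initVal

/-- Process `p` has decided `x` in the configuration `C`. -/
def Decided (A : SwapAlgorithm.{u, v} n m b) (C : A.Config) (p : Fin n) (x : Fin m) : Prop :=
  A.action p (C.state p) = SwapAction.decided x

/-- A step by `p` from `C` to `C'`: `p` has not decided in `C`, it applies the operation `Swap(w)`
to the object `B` to which it is poised to apply it, obtains the old value of `B` as the response,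
and moves to a new state that is possible after this response. -/
def Step (A : SwapAlgorithm.{u, v} n m b) (p : Fin n) (C C' : A.Config) : Prop :=
  ∃ B w, A.action p (C.state p) = SwapAction.swap B w ∧
    ∃ s ∈ A.next p (C.state p) (C.val B),
      C' = { state := Function.update C.state p s, val := Function.update C.val B w }

/-- `A.Exec C h C'`: there is a finite execution from `C` to `C'` whose steps are performed, in
order, by the processes listed in `h`. -/
inductive Exec (A : SwapAlgorithm.{u, v} n m b) : A.Config → List (Fin n) → A.Config → Prop where
  | nil (C : A.Config) : Exec A C [] C
  | cons {C C' C'' : A.Config} {p : Fin n} {h : List (Fin n)} :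
      A.Step p C C' → Exec A C' h C'' → Exec A C (p :: h) C''

/-- `C` occurs in an execution from some initial configuration. -/
def Reachable (A : SwapAlgorithm.{u, v} n m b) (C : A.Config) : Prop :=
  ∃ input h, A.Exec (A.initConfig input) h C

/-- `k`-agreement: in every execution from an initial configuration at most `k` values are decided.
(A process that has decided takes no more steps, so the values decided during an execution are
those that are decided in its final configuration.) -/
def KAgreement (A : SwapAlgorithm.{u, v} n m b) (k : ℕ) : Prop :=
  ∀ input h C, A.Exec (A.initConfig input) h C → {x | ∃ p, A.Decided C p x}.ncard ≤ k

/-- Validity: every decided value is the input of some process. -/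
def Validity (A : SwapAlgorithm.{u, v} n m b) : Prop :=
  ∀ input h C, A.Exec (A.initConfig input) h C → ∀ p x, A.Decided C p x → ∃ q, input q = x

/-- `A` is a `k`-set agreement algorithm. -/
def IsSetAgreement (A : SwapAlgorithm.{u, v} n m b) (k : ℕ) : Prop :=
  A.KAgreement k ∧ A.Validity

/-- Nondeterministic solo-termination: from every reachable configuration, every process has a solo
execution that ends with a configuration in which it has decided. -/
def NondetSoloTerminating (A : SwapAlgorithm.{u, v} n m b) : Prop :=
  ∀ C, A.Reachable C → ∀ p, ∃ h C', (∀ q ∈ h, q = p) ∧ A.Exec C h C' ∧ ∃ x, A.Decided C' p x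

/-- The local computation after each step has exactly one outcome. -/
def Deterministic (A : SwapAlgorithm.{u, v} n m b) : Prop :=
  ∀ p s B w, A.action p s = SwapAction.swap B w → ∀ r, ∃ s', A.next p s r = {s'}

/-- Obstruction-freedom: deterministic and nondeterministic solo-terminating. -/
def ObstructionFree (A : SwapAlgorithm.{u, v} n m b) : Prop :=
  A.Deterministic ∧ A.NondetSoloTerminating

end SwapAlgorithm

/-! ### The algorithm -/

namespace SetAgreeSwap

/-- The local variables of a process: its lap counter `U`, the (0-based) index of the object to
which it applies its next swap, the flag `conflict`, and the value it has decided, if any. -/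
structure LocalState (m b : ℕ) where
  lap : Fin m → ℕ
  idx : Fin b
  conflict : Bool
  decision : Option (Fin m)

theorem leaders_nonempty {m : ℕ} (hm : 0 < m) (U : Fin m → ℕ) :
    (Finset.univ.filter fun j => U j = Finset.univ.sup U).Nonempty := by
  obtain ⟨j, -, hj⟩ := Finset.exists_mem_eq_sup Finset.univ ⟨(⟨0, hm⟩ : Fin m), Finset.mem_univ _⟩ U
  exact ⟨j, by simp [hj]⟩

/-- The least `j` such that `U j` is the maximum of `U`. -/
def leader {m : ℕ} (hm : 0 < m) (U : Fin m → ℕ) : Fin m :=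
  (Finset.univ.filter fun j => U j = Finset.univ.sup U).min' (leaders_nonempty hm U)

/-- The local computation of a process at the end of an iteration of its main loop, up to its next
swap, where `U` and `conflict` are its lap counter and conflict flag at this point. If there was a
conflict, it restarts the loop. Otherwise it decides the leading value if this is at least two laps
ahead of all others, and else it completes a lap for this value and restarts the loop. -/
def endLoop {m b : ℕ} (hm : 0 < m) (hb : 0 < b) (U : Fin m → ℕ) (conflict : Bool) :
    LocalState m b :=
  let x := leader hm U
  if conflict then
    { lap := U, idx := ⟨0, hb⟩, conflict := false, decision := none }
  else if ∀ j, j ≠ x → U j + 2 ≤ U x then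
    { lap := U, idx := ⟨0, hb⟩, conflict := false, decision := some x }
  else
    { lap := Function.update U x (U x + 1), idx := ⟨0, hb⟩, conflict := false, decision := none }

/-- The local computation of process `p` after its swap of `⟨U, p⟩` returned `r = ⟨U', p'⟩`. It
records a conflict if `r ≠ ⟨U, p⟩`, replaces `U` by the componentwise maximum of `U` and `U'` (which
changes nothing if `U' = U`), and goes on to the next object, or to the end of the loop. -/
def localStep {n m b : ℕ} (hm : 0 < m) (hb : 0 < b) (p : Fin n) (s : LocalState m b)
    (r : (Fin m → ℕ) × Option (Fin n)) : LocalState m b :=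
  let conflict : Bool := s.conflict || decide (r ≠ (s.lap, some p))
  let U : Fin m → ℕ := fun j => max (s.lap j) (r.1 j)
  if h : s.idx.val + 1 < b then
    { lap := U, idx := ⟨s.idx.val + 1, h⟩, conflict := conflict, decision := none }
  else
    endLoop hm hb U conflict

end SetAgreeSwap

/-- The `m`-valued `k`-set agreement algorithm for `n` processes from `n - k` swap objects. A swap
object stores a lap counter and an identifier, where `none` is the initial identifier `⊥`. A process
with input `x` starts with `U x = 1` and `U j = 0` for `j ≠ x`, and it is poised to swap its lap
counter and its identifier into the first object. -/
def setAgreeSwap (n m k : ℕ) (hm : 0 < m) (hkn : k < n) : SwapAlgorithm.{0, 0} n m (n - k) where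
  Val := (Fin m → ℕ) × Option (Fin n)
  State := SetAgreeSwap.LocalState m (n - k)
  initVal := fun _ => (fun _ => 0, none)
  initState := fun _ x =>
    { lap := Function.update (fun _ => 0) x 1
      idx := ⟨0, Nat.sub_pos_of_lt hkn⟩
      conflict := false
      decision := none }
  action := fun p s =>
    match s.decision with
    | some x => SwapAction.decided x
    | none => SwapAction.swap s.idx (s.lap, some p)
  next := fun p s r => {SetAgreeSwap.localStep hm (Nat.sub_pos_of_lt hkn) p s r}
  next_nonempty := fun _ _ _ _ _ _ => Set.singleton_nonempty _

/-! Lower bound: let one process with input `x` decide alone while all others have input `y`. The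
others cannot tell this from the all-`y` configuration. Run one of them to its decision `y` in the
latter and copy its steps in the former: it must meet an object with different contents, and its
swap makes that object agree. So each of the `n - 1` processes uses up a different object
(`card_le_ncard_diff`).

Solo runs: once the objects are dominated by the counter of `p`, at most two iterations raise the
lead of `p` by one or end in a decision, and a lead of two suffices (`bounded_seven`).

Agreement: call `p` clean with `U` when all objects hold its pair. As only `p` writes its
identifier, a conflict-free iteration shows that `p` was clean (`exists_clean`), so every decision
and every lap beyond the first goes back to a clean moment. A swap that removes `U` from an object
teaches `U` to the swapper. Hence if `U` once filled all objects and has since been displaced from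
all of them, any `k` processes include one that was active then and knows `U` now
(`exists_informed`).

Suppose more than `k` values `x` are decided, with counters `U x`. Let `y` be the one whose decider
is clean last. Information spreads so that `U y` dominates all `U x`. Let `L` be the largest `U x x`
with `x ≠ y`. Since `U y y > L`, some process was clean earlier with a counter `W` led by `y` with
`W y = L - 1`; by the margin of two, no `U x` with `x ≠ y` dominates `W`. If some decider of a value
other than `y` is clean at this time or later, one of these deciders must have learned `W`; if none
is, the value `L` must have spread into `W`, whose maximum is `L - 1`. Both are impossible. -/

namespace SwapAlgorithm

/-! ### Lower bound for consensus -/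

variable {n m b : ℕ} {A : SwapAlgorithm.{u, v} n m b}

theorem Exec.append {C C' C'' : A.Config} {h h' : List (Fin n)} (e : A.Exec C h C')
    (e' : A.Exec C' h' C'') : A.Exec C (h ++ h') C'' := by
  induction e with
  | nil => exact e'
  | cons hs _ ih => exact Exec.cons hs (ih e')

theorem Reachable.exec {C C' : A.Config} {h : List (Fin n)} (hC : A.Reachable C)
    (e : A.Exec C h C') : A.Reachable C' := by
  obtain ⟨i, h₀, e₀⟩ := hC
  exact ⟨i, h₀ ++ h, e₀.append e⟩

theorem Step.state_eq {C C' : A.Config} {p q : Fin n} (hs : A.Step p C C') (hq : q ≠ p) :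
    C'.state q = C.state q := by
  obtain ⟨B, w, -, s, -, rfl⟩ := hs
  simp [hq]

theorem Exec.state_eq {C C' : A.Config} {h : List (Fin n)} {q : Fin n} (e : A.Exec C h C')
    (hq : q ∉ h) : C'.state q = C.state q := by
  induction e with
  | nil => rfl
  | cons hs _ ih =>
    rw [List.mem_cons, not_or] at hq
    rw [ih hq.2, hs.state_eq hq.1]

/-- The objects with different values in two configurations. -/
def diff (C D : A.Config) : Set (Fin b) := {B | C.val B ≠ D.val B}

/-- A solo execution can be mirrored from another configuration, either completely, or up to and
including a swap that makes an object agree that did not agree before. -/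
theorem Exec.mirror {q : Fin n} {D D' : A.Config} {h : List (Fin n)} (e : A.Exec D h D') :
    ∀ C : A.Config, (∀ r ∈ h, r = q) → C.state q = D.state q →
      (∃ C', A.Exec C h C' ∧ C'.state q = D'.state q) ∨
      ∃ h₁ C₁ D₁, (∀ r ∈ h₁, r = q) ∧ A.Exec C h₁ C₁ ∧ A.Exec D h₁ D₁ ∧
        diff C₁ D₁ ⊂ diff C D := by
  induction e with
  | nil D => exact fun C _ hq => Or.inl ⟨C, Exec.nil C, hq⟩
  | @cons D D₁ D₂ p h hs e ih =>
    intro C hh hq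
    obtain rfl : p = q := hh p (by simp)
    obtain ⟨B, w, ha, s, hsn, rfl⟩ := hs
    have sub : ∀ s' : A.State, diff (A := A)
        ⟨Function.update C.state p s', Function.update C.val B w⟩
        ⟨Function.update D.state p s, Function.update D.val B w⟩ ⊆ diff C D := by
      intro s' B' hB'
      by_cases hb : B' = B
      · subst hb; simp [diff] at hB'
      · simpa [diff, hb] using hB'
    by_cases hB : C.val B = D.val B
    · have st : A.Step p C ⟨Function.update C.state p s, Function.update C.val B w⟩ :=
        ⟨B, w, by rw [hq, ha], s, by rw [hq, hB]; exact hsn, rfl⟩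
      rcases ih ⟨Function.update C.state p s, Function.update C.val B w⟩
        (fun r hr => hh r (by simp [hr])) (by simp) with ⟨C', e', hC'⟩ | ⟨h₁, C₁, D₁, a, b, c, d⟩
      · exact Or.inl ⟨C', Exec.cons st e', hC'⟩
      · refine Or.inr ⟨p :: h₁, C₁, D₁, by simpa using a, Exec.cons st b,
          Exec.cons ⟨B, w, ha, s, hsn, rfl⟩ c, d.trans_subset (sub s)⟩
    -- The two responses differ, so nothing is known about the new states of `p`, but both runs
    -- store the same `w` in `B`.
    · obtain ⟨s', hs'⟩ := A.next_nonempty p (C.state p) B w (by rw [hq, ha]) (C.val B)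
      refine Or.inr ⟨[p], _, _, by simp, Exec.cons ⟨B, w, by rw [hq, ha], s', hs', rfl⟩ (Exec.nil _),
        Exec.cons ⟨B, w, ha, s, hsn, rfl⟩ (Exec.nil _), (sub s').ssubset_of_ne fun h => ?_⟩
      have : B ∈ diff C D := hB
      rw [← h] at this
      simp [diff] at this

theorem KAgreement.eq (hA : A.KAgreement 1) {C : A.Config} (hC : A.Reachable C) {p q : Fin n}
    {x y : Fin m} (hp : A.Decided C p x) (hq : A.Decided C q y) : x = y := by
  obtain ⟨i, h, e⟩ := hC
  exact (Set.ncard_le_one_iff (Set.toFinite _)).1 (hA i h C e) ⟨p, hp⟩ ⟨q, hq⟩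

/-- Processes that cannot distinguish two configurations are at most as many as the objects on which
they differ, if these configurations lead to different decisions. -/
theorem card_le_ncard_diff (hA : A.IsSetAgreement 1) (hN : A.NondetSoloTerminating)
    {p : Fin n} {x y : Fin m} (hxy : x ≠ y) (S : Finset (Fin n)) :
    ∀ C D : A.Config, A.Reachable C → A.Decided C p x → p ∉ S →
      (∃ h, A.Exec (A.initConfig fun _ => y) h D) → (∀ q ∈ S, C.state q = D.state q) →
      S.card ≤ (diff C D).ncard := by
  induction S using Finset.induction_on with
  | empty => simp
  | insert q S hqS ih =>
    intro C D hC hp hpS ⟨hD, eD⟩ hS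
    rw [Finset.mem_insert, not_or] at hpS
    obtain ⟨h, D', hh, e, z, hz⟩ := hN D ⟨_, hD, eD⟩ q
    obtain ⟨-, rfl⟩ := hA.2 _ _ _ (eD.append e) q z hz
    have solo : ∀ {h' : List (Fin n)} {r : Fin n}, (∀ a ∈ h', a = q) → r ≠ q → r ∉ h' :=
      fun h1 h2 h3 => h2 (h1 _ h3)
    -- A complete copy would let `q` decide `y` although `p` has decided `x`. Otherwise an object
    -- has been made equal, and `q`, whose two states may now differ, is dropped from the set.
    rcases e.mirror C hh (hS q (by simp)) with ⟨C', e', hC'⟩ | ⟨h₁, C₁, D₁, a, e₁, e₂, d⟩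
    · refine absurd (hA.1.eq (hC.exec e') (p := p) (q := q) ?_ ?_) hxy
      · rw [Decided, e'.state_eq (solo hh hpS.1)]; exact hp
      · rw [Decided, hC']; exact hz
    · have := ih C₁ D₁ (hC.exec e₁) (by rw [Decided, e₁.state_eq (solo a hpS.1)]; exact hp) hpS.2
        ⟨_, eD.append e₂⟩ fun r hr => by
          have hrq : r ≠ q := fun h => hqS (h ▸ hr)
          rw [e₁.state_eq (solo a hrq), e₂.state_eq (solo a hrq)]
          exact hS r (by simp [hr])
      have := Set.ncard_lt_ncard d (Set.toFinite _)
      rw [Finset.card_insert_of_notMem hqS]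
      omega

/-- Consensus from swap objects needs at least `n - 1` of them. -/
theorem sub_one_le_of_consensus (hn : 0 < n) (hm : 2 ≤ m) (hA : A.IsSetAgreement 1)
    (hN : A.NondetSoloTerminating) : n - 1 ≤ b := by
  set p : Fin n := ⟨0, hn⟩
  set x : Fin m := ⟨0, by omega⟩
  set y : Fin m := ⟨1, by omega⟩
  have hxy : x ≠ y := by simp [x, y]
  obtain ⟨h, C, hh, e, z, hz⟩ := hN (A.initConfig fun _ => x) ⟨_, _, Exec.nil _⟩ p
  obtain ⟨-, rfl⟩ := hA.2 _ _ _ e p z hz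
  rcases e.mirror (A.initConfig (Function.update (fun _ => y) p x)) hh (by simp [initConfig]) with
    ⟨C', e', hC'⟩ | ⟨h₁, C₁, D₁, -, -, -, d⟩
  · have := card_le_ncard_diff hA hN hxy (Finset.univ.erase p) C' (A.initConfig fun _ => y)
      ⟨_, _, e'⟩ (by rw [Decided, hC']; exact hz) (by simp) ⟨_, Exec.nil _⟩ fun q hq => by
        have hqp : q ≠ p := by simpa using hq
        rw [e'.state_eq fun h => hqp (hh _ h)]
        simp [initConfig, hqp]
    rw [Finset.card_erase_of_mem (Finset.mem_univ _), Finset.card_univ, Fintype.card_fin] at this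
    refine this.trans ((Set.ncard_le_ncard (Set.subset_univ _)).trans ?_)
    simp [Set.ncard_univ]
  -- The objects start out equal whatever the inputs, so no disagreement is left to repair.
  · have : diff (A.initConfig (Function.update (fun _ => y) p x)) (A.initConfig fun _ => x) = ∅ := by
      simp [diff, initConfig]
    rw [this] at d
    exact absurd (Set.empty_subset _) d.2

end SwapAlgorithm

/-! ### Leaders, gaps and the end of an iteration -/

namespace SetAgreeSwap

variable {n m b : ℕ} {hm : 0 < m} {hb : 0 < b}

theorem le_leader (hm : 0 < m) (U : Fin m → ℕ) (j : Fin m) : U j ≤ U (leader hm U) := by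
  have := (Finset.mem_filter.1 (Finset.min'_mem _ (leaders_nonempty hm U))).2
  rw [leader, this]
  exact Finset.le_sup (f := U) (Finset.mem_univ j)

theorem leader_eq {U : Fin m → ℕ} {x : Fin m} (h : ∀ j, j ≠ x → U j < U x) : leader hm U = x := by
  by_contra hne
  exact absurd (le_leader hm U x) (not_le.2 (h _ hne))

/-- The leading value is at least `d` laps ahead of all others. -/
def Gap (hm : 0 < m) (d : ℕ) (U : Fin m → ℕ) : Prop :=
  ∀ j, j ≠ leader hm U → U j + d ≤ U (leader hm U)

theorem gap_zero (hm : 0 < m) (U : Fin m → ℕ) : Gap hm 0 U := fun j _ => le_leader hm U j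

/-- The incremented component becomes the strict maximum, so breaking ties by least index does not
move the leader. -/
theorem Gap.update {d : ℕ} {U : Fin m → ℕ} (h : Gap hm d U) :
    Gap hm (d + 1) (Function.update U (leader hm U) (U (leader hm U) + 1)) := by
  have : leader hm (Function.update U (leader hm U) (U (leader hm U) + 1)) = leader hm U := by
    refine leader_eq fun j hj => ?_
    simpa [hj, Nat.lt_succ_iff] using le_leader hm U j
  intro j hj
  rw [this] at hj ⊢
  have := h j hj
  simp [hj]
  omega

/-- The outcomes of the local computation at the end of an iteration. -/
theorem endLoop_cases (hm : 0 < m) (hb : 0 < b) (U : Fin m → ℕ) (c : Bool) :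
    (c = true ∧ endLoop hm hb U c = ⟨U, ⟨0, hb⟩, false, none⟩) ∨
    (c = false ∧ Gap hm 2 U ∧ endLoop hm hb U c = ⟨U, ⟨0, hb⟩, false, some (leader hm U)⟩) ∨
    (c = false ∧ ¬ Gap hm 2 U ∧ endLoop hm hb U c =
      ⟨Function.update U (leader hm U) (U (leader hm U) + 1), ⟨0, hb⟩, false, none⟩) := by
  cases c
  · by_cases h : Gap hm 2 U
    · refine Or.inr (Or.inl ⟨rfl, h, ?_⟩)
      simp only [endLoop]
      rw [if_neg (by simp)]
      exact if_pos h
    · refine Or.inr (Or.inr ⟨rfl, h, ?_⟩)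
      simp only [endLoop]
      rw [if_neg (by simp)]
      exact if_neg h
  · exact Or.inl ⟨rfl, by simp [endLoop]⟩

theorem le_endLoop_lap (U : Fin m → ℕ) (c : Bool) : U ≤ (endLoop hm hb U c).lap := by
  rcases endLoop_cases hm hb U c with ⟨-, h⟩ | ⟨-, -, h⟩ | ⟨-, -, h⟩ <;> rw [h]
  intro j
  by_cases hj : j = leader hm U
  · subst hj; simp
  · simp [hj]

/-! ### Length of solo runs -/

section Solo

variable {p : Fin n}

/-- The values of the objects after the pending swap of `p` in the state `s`. -/
def nextVal (p : Fin n) (s : LocalState m b) (v : Fin b → (Fin m → ℕ) × Option (Fin n)) :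
    Fin b → (Fin m → ℕ) × Option (Fin n) :=
  Function.update v s.idx (s.lap, some p)

/-- `p` takes at least `l` steps in its solo execution from the state `s` and object values `v`. -/
def RunsFor (hm : 0 < m) (hb : 0 < b) (p : Fin n) :
    ℕ → LocalState m b → (Fin b → (Fin m → ℕ) × Option (Fin n)) → Prop
  | 0, _, _ => True
  | l + 1, s, v => s.decision = none ∧
      RunsFor hm hb p l (localStep hm hb p s (v s.idx)) (nextVal p s v)

/-- `p` takes at most `N` steps in its solo execution from the state `s` and object values `v`. -/
def Bounded (hm : 0 < m) (hb : 0 < b) (p : Fin n) (N : ℕ) (s : LocalState m b)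
    (v : Fin b → (Fin m → ℕ) × Option (Fin n)) : Prop :=
  ∀ l, RunsFor hm hb p l s v → l ≤ N

theorem bounded_of_decision {N : ℕ} {s : LocalState m b} {v} (h : s.decision ≠ none) :
    Bounded hm hb p N s v := by
  rintro (_ | l) hl
  · exact Nat.zero_le _
  · exact absurd hl.1 h

theorem Bounded.succ {N : ℕ} {s : LocalState m b} {v}
    (h : Bounded hm hb p N (localStep hm hb p s (v s.idx)) (nextVal p s v)) :
    Bounded hm hb p (N + 1) s v := by
  rintro (_ | l) hl
  · exact Nat.zero_le _
  · exact Nat.succ_le_succ (h l hl.2)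

theorem Bounded.mono {N N' : ℕ} {s : LocalState m b} {v} (h : Bounded hm hb p N s v)
    (hN : N ≤ N') : Bounded hm hb p N' s v := fun l hl => (h l hl).trans hN

theorem localStep_of_lt {s : LocalState m b} (r : (Fin m → ℕ) × Option (Fin n))
    (h : s.idx.val + 1 < b) : localStep hm hb p s r =
      ⟨s.lap ⊔ r.1, ⟨s.idx.val + 1, h⟩, s.conflict || decide (r ≠ (s.lap, some p)), none⟩ := by
  simp only [localStep]
  rw [dif_pos h]
  rfl

theorem localStep_of_not_lt {s : LocalState m b} (r : (Fin m → ℕ) × Option (Fin n))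
    (h : ¬ s.idx.val + 1 < b) : localStep hm hb p s r =
      endLoop hm hb (s.lap ⊔ r.1) (s.conflict || decide (r ≠ (s.lap, some p))) := by
  simp only [localStep]
  rw [dif_neg h]
  rfl

/-- Induction over the steps of an iteration of the main loop. -/
theorem bounded_of_loop {N : ℕ}
    (I : LocalState m b → (Fin b → (Fin m → ℕ) × Option (Fin n)) → Prop)
    (hI : ∀ s v, I s v → s.idx.val + 1 < b →
      I (localStep hm hb p s (v s.idx)) (nextVal p s v))
    (hN : ∀ s v, I s v → ¬ s.idx.val + 1 < b →
      Bounded hm hb p N (localStep hm hb p s (v s.idx)) (nextVal p s v))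
    (s : LocalState m b) (v) (h : I s v) : Bounded hm hb p (b - s.idx + N) s v := by
  obtain ⟨c, hc⟩ : ∃ c, b - s.idx.val = c := ⟨_, rfl⟩
  induction c generalizing s v with
  | zero => have := s.idx.isLt; omega
  | succ c ih =>
    by_cases hlt : s.idx.val + 1 < b
    · have := ih _ _ (hI s v h hlt) (by rw [localStep_of_lt _ hlt]; simp only; omega)
      refine this.succ.mono ?_
      rw [localStep_of_lt _ hlt]
      simp only
      omega
    · exact (hN s v h hlt).succ.mono (by omega)

/-- An iteration in which all objects hold the pair of `p`. -/
theorem bounded_of_forall_eq {d N : ℕ}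
    (H : d < 2 → ∀ U v, Gap hm (d + 1) U → (∀ j, (v j).1 ≤ U) →
      Bounded hm hb p N ⟨U, ⟨0, hb⟩, false, none⟩ v)
    {U : Fin m → ℕ} {v} (hU : Gap hm d U) (hv : ∀ j, v j = (U, some p)) :
    Bounded hm hb p (b + N) ⟨U, ⟨0, hb⟩, false, none⟩ v := by
  refine bounded_of_loop
    (fun s v => s.conflict = false ∧ s.lap = U ∧ ∀ j, v j = (U, some p)) ?_ ?_ _ _ ⟨rfl, rfl, hv⟩
  · rintro s v ⟨hc, rfl, hv⟩ hlt
    rw [localStep_of_lt _ hlt]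
    refine ⟨by simp [hc, hv], by simp [hv], fun j => ?_⟩
    by_cases hj : j = s.idx
    · subst hj; simp [nextVal]
    · simp [nextVal, hj, hv]
  · rintro s v ⟨hc, rfl, hv⟩ hlt
    rw [localStep_of_not_lt _ hlt]
    simp only [hc, hv, sup_idem, ne_eq, not_true_eq_false, decide_false, Bool.or_self]
    rcases endLoop_cases hm hb s.lap false with ⟨h, -⟩ | ⟨-, -, h⟩ | ⟨-, hg, h⟩
    · simp at h
    · rw [h]; exact bounded_of_decision (by simp)
    · rw [h]
      -- With a gap of two the process would have decided.
      have hd : d < 2 := by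
        by_contra hd
        exact hg fun j hj => (by have := hU j hj; omega)
      refine H hd _ _ hU.update fun j => ?_
      by_cases hj : j = s.idx
      · subst hj; simp [nextVal]
      · simp [nextVal, hj, hv]

/-- An iteration in which the lap counters of all objects are dominated by that of `p`. -/
theorem bounded_of_forall_le {d N : ℕ}
    (H : d < 2 → ∀ U v, Gap hm (d + 1) U → (∀ j, (v j).1 ≤ U) →
      Bounded hm hb p N ⟨U, ⟨0, hb⟩, false, none⟩ v)
    (H' : ∀ U v, Gap hm d U → (∀ j, v j = (U, some p)) →
      Bounded hm hb p N ⟨U, ⟨0, hb⟩, false, none⟩ v)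
    {U : Fin m → ℕ} {v} (hU : Gap hm d U) (hv : ∀ j, (v j).1 ≤ U) :
    Bounded hm hb p (b + N) ⟨U, ⟨0, hb⟩, false, none⟩ v := by
  refine bounded_of_loop
    (fun s v => s.lap = U ∧ (∀ j, (v j).1 ≤ U) ∧ ∀ j < s.idx, v j = (U, some p))
    ?_ ?_ _ _ ⟨rfl, hv, fun j hj => absurd hj (Nat.not_lt_zero _)⟩
  · rintro s v ⟨rfl, hv, hv'⟩ hlt
    rw [localStep_of_lt _ hlt]
    refine ⟨by simp [hv], fun j => ?_, fun j hj => ?_⟩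
    · by_cases hj : j = s.idx
      · subst hj; simp [nextVal]
      · simp [nextVal, hj, hv]
    · by_cases hj' : j = s.idx
      · subst hj'; simp [nextVal]
      · have : j < s.idx := by
          rw [Fin.lt_def] at hj ⊢
          have := Fin.val_ne_of_ne hj'
          simp only at hj
          omega
        simp [nextVal, hj', hv' j this]
  · rintro s v ⟨rfl, hv, hv'⟩ hlt
    have hall : ∀ j, nextVal p s v j = (s.lap, some p) := by
      intro j
      by_cases hj : j = s.idx
      · subst hj; simp [nextVal]
      · have : j < s.idx := by
          rw [Fin.lt_def]
          have := Fin.val_ne_of_ne hj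
          omega
        simp [nextVal, hj, hv' j this]
    rw [localStep_of_not_lt _ hlt, sup_eq_left.2 (hv _)]
    generalize (s.conflict || decide (v s.idx ≠ (s.lap, some p))) = c
    have hle := le_endLoop_lap (hm := hm) (hb := hb) s.lap c
    -- A conflict here can come only from a foreign identifier or a smaller counter. It leaves the
    -- lap counter unchanged, and every object now holds the pair of `p`, so the next iteration has
    -- no conflict.
    rcases endLoop_cases hm hb s.lap c with ⟨-, h⟩ | ⟨-, -, h⟩ | ⟨-, hg, h⟩ <;> rw [h]
    · exact H' _ _ hU hall
    · exact bounded_of_decision (by simp)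
    · have hd : d < 2 := by
        by_contra hd
        exact hg fun j hj => (by have := hU j hj; omega)
      rw [h] at hle
      exact H hd _ _ hU.update fun j => by rw [hall]; exact hle

/-- One iteration absorbs all larger counters. For each gap `0`, `1`, `2` there follow at most two
iterations: one with a conflict, and one without that raises the gap or decides. This gives `1 + 2 *
3` iterations. -/
theorem bounded_seven (U : Fin m → ℕ) (v) :
    Bounded hm hb p (7 * b) ⟨U, ⟨0, hb⟩, false, none⟩ v := by
  -- From `e2` to `a0` the bounds are `b, 2b, …, 6b`; at gap two the continuation is vacuous, hence
  -- `N = 0`.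
  have e2 := fun U v => bounded_of_forall_eq (hm := hm) (hb := hb) (p := p) (d := 2) (N := 0)
    (fun h => absurd h (lt_irrefl 2)) (U := U) (v := v)
  have a2 := fun U v => bounded_of_forall_le (hm := hm) (hb := hb) (p := p) (d := 2)
    (fun h => absurd h (lt_irrefl 2)) e2 (U := U) (v := v)
  have e1 := fun U v => bounded_of_forall_eq (hm := hm) (hb := hb) (p := p) (d := 1)
    (fun _ => a2) (U := U) (v := v)
  have a1 := fun U v => bounded_of_forall_le (hm := hm) (hb := hb) (p := p) (d := 1)
    (fun _ U v h h' => (a2 U v h h').mono (Nat.le_add_left _ b)) e1 (U := U) (v := v)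
  have e0 := fun U v => bounded_of_forall_eq (hm := hm) (hb := hb) (p := p) (d := 0)
    (fun _ => a1) (U := U) (v := v)
  have a0 := fun U v => bounded_of_forall_le (hm := hm) (hb := hb) (p := p) (d := 0)
    (fun _ U v h h' => (a1 U v h h').mono (Nat.le_add_left _ b)) e0 (U := U) (v := v)
  refine (bounded_of_loop (N := 6 * b) (fun s v => ∀ j < s.idx, (v j).1 ≤ s.lap)
    ?_ ?_ _ _ fun j hj => absurd hj (Nat.not_lt_zero _)).mono (by simp only; omega)
  · intro s v hv hlt j hj
    rw [localStep_of_lt _ hlt] at hj ⊢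
    by_cases hj' : j = s.idx
    · subst hj'; simp [nextVal]
    · have : j < s.idx := by
        rw [Fin.lt_def] at hj ⊢
        have := Fin.val_ne_of_ne hj'
        simp only at hj
        omega
      simpa [nextVal, hj'] using le_sup_of_le_left (hv j this)
  · intro s v hv hlt
    rw [localStep_of_not_lt _ hlt]
    generalize (s.conflict || decide (v s.idx ≠ (s.lap, some p))) = c
    have hall : ∀ j, (nextVal p s v j).1 ≤ s.lap ⊔ (v s.idx).1 := by
      intro j
      by_cases hj : j = s.idx
      · subst hj; simp [nextVal]
      · have : j < s.idx := by
          rw [Fin.lt_def]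
          have := Fin.val_ne_of_ne hj
          omega
        simpa [nextVal, hj] using le_sup_of_le_left (hv j this)
    have hle := le_endLoop_lap (hm := hm) (hb := hb) (s.lap ⊔ (v s.idx).1) c
    rcases endLoop_cases hm hb (s.lap ⊔ (v s.idx).1) c with ⟨-, h⟩ | ⟨-, -, h⟩ | ⟨-, -, h⟩ <;>
      rw [h] at hle ⊢
    · exact (a0 _ _ (gap_zero hm _) hall).mono (by omega)
    · exact bounded_of_decision (by simp)
    · exact (a0 _ _ (gap_zero hm _) fun j => (hall j).trans hle).mono (by omega)

/-- Every solo execution has at most `8 b` steps. -/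
theorem bounded_eight (s : LocalState m b) (v) : Bounded hm hb p (8 * b) s v := by
  -- Nothing is known about the current iteration, which costs at most `b` further steps.
  refine (bounded_of_loop (N := 7 * b) (fun _ _ => True) (fun _ _ _ _ => trivial) ?_ s v
    trivial).mono (by omega)
  intro s v _ hlt
  rw [localStep_of_not_lt _ hlt]
  generalize (s.conflict || decide (v s.idx ≠ (s.lap, some p))) = c
  rcases endLoop_cases hm hb (s.lap ⊔ (v s.idx).1) c with ⟨-, h⟩ | ⟨-, -, h⟩ | ⟨-, -, h⟩ <;> rw [h]
  · exact bounded_seven _ _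
  · exact bounded_of_decision (by simp)
  · exact bounded_seven _ _

end Solo


/-! ### Runs and the clean moments behind laps and decisions -/

section Run

variable {k : ℕ}

/-- A run of the algorithm with `b` objects, that may pause between its steps. -/
structure IsRun (hm : 0 < m) (hb : 0 < b) (input : Fin n → Fin m)
    (st : ℕ → Fin n → LocalState m b) (val : ℕ → Fin b → (Fin m → ℕ) × Option (Fin n)) :
    Prop where
  st_zero : ∀ p, st 0 p = ⟨Function.update (fun _ => 0) (input p) 1, ⟨0, hb⟩, false, none⟩
  val_zero : ∀ j, val 0 j = (fun _ => 0, none)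
  succ : ∀ t, (st (t + 1) = st t ∧ val (t + 1) = val t) ∨ ∃ p, (st t p).decision = none ∧
    st (t + 1) = Function.update (st t) p (localStep hm hb p (st t p) (val t (st t p).idx)) ∧
    val (t + 1) = nextVal p (st t p) (val t)

theorem le_localStep_lap (p : Fin n) (s : LocalState m b) (r : (Fin m → ℕ) × Option (Fin n)) :
    s.lap ⊔ r.1 ≤ (localStep hm hb p s r).lap := by
  by_cases h : s.idx.val + 1 < b
  · rw [localStep_of_lt _ h]
  · rw [localStep_of_not_lt _ h]
    exact le_endLoop_lap _ _

/-- With the response `r`, process `p` in state `s` finishes an iteration without a conflict. -/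
structure Commits (p : Fin n) (s : LocalState m b) (r : (Fin m → ℕ) × Option (Fin n)) : Prop where
  conflict : s.conflict = false
  last : ¬ s.idx.val + 1 < b
  response : r = (s.lap, some p)

/-- The outcomes of a step: no completed lap or decision, a decision, or a completed lap. -/
theorem localStep_cases (hm : 0 < m) (hb : 0 < b) (p : Fin n) (s : LocalState m b)
    (r : (Fin m → ℕ) × Option (Fin n)) :
    ((localStep hm hb p s r).decision = none ∧ (localStep hm hb p s r).lap = s.lap ⊔ r.1) ∨
    Commits p s r ∧ (Gap hm 2 s.lap ∧ (localStep hm hb p s r).lap = s.lap ∧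
        (localStep hm hb p s r).decision = some (leader hm s.lap) ∨
      (localStep hm hb p s r).decision = none ∧ (localStep hm hb p s r).lap =
        Function.update s.lap (leader hm s.lap) (s.lap (leader hm s.lap) + 1)) := by
  by_cases h : s.idx.val + 1 < b
  · rw [localStep_of_lt _ h]; simp
  · rw [localStep_of_not_lt _ h]
    obtain ⟨c, hc⟩ : ∃ c, (s.conflict || decide (r ≠ (s.lap, some p))) = c := ⟨_, rfl⟩
    rw [hc]
    cases c with
    | true =>
      rcases endLoop_cases hm hb (s.lap ⊔ r.1) true with ⟨-, h⟩ | ⟨h, -⟩ | ⟨h, -⟩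
      · rw [h]; simp
      · simp at h
      · simp at h
    | false =>
      rw [Bool.or_eq_false_iff, decide_eq_false_iff_not, not_not] at hc
      have hU : s.lap ⊔ r.1 = s.lap := by rw [hc.2]; exact sup_idem _
      rw [hU]
      refine Or.inr ⟨⟨hc.1, h, hc.2⟩, ?_⟩
      rcases endLoop_cases hm hb s.lap false with ⟨h, -⟩ | ⟨-, hg, h⟩ | ⟨-, -, h⟩
      · simp at h
      · rw [h]; simp [hg]
      · rw [h]; simp

/-- The end of the loop resets the flag and the index together; within an iteration the flag stays
clear only if the response is the process's own pair. -/
theorem localStep_conflict {p : Fin n} {s : LocalState m b} {r : (Fin m → ℕ) × Option (Fin n)}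
    (hd : (localStep hm hb p s r).conflict = false) :
    (localStep hm hb p s r).idx = ⟨0, hb⟩ ∨ ∃ h : s.idx.val + 1 < b, s.conflict = false ∧
      r = (s.lap, some p) ∧ (localStep hm hb p s r).lap = s.lap ∧
      (localStep hm hb p s r).idx = ⟨s.idx.val + 1, h⟩ := by
  by_cases h : s.idx.val + 1 < b
  · rw [localStep_of_lt _ h] at hd ⊢
    simp only [Bool.or_eq_false_iff, decide_eq_false_iff_not, not_not] at hd
    refine Or.inr ⟨h, hd.1, hd.2, ?_, rfl⟩
    rw [hd.2]
    exact sup_idem _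
  · rw [localStep_of_not_lt _ h]
    left
    rcases endLoop_cases hm hb (s.lap ⊔ r.1) (s.conflict || decide (r ≠ (s.lap, some p))) with
      ⟨-, h⟩ | ⟨-, -, h⟩ | ⟨-, -, h⟩ <;> rw [h]

/-- All objects hold the pair of the lap counter `U` and the identifier of the process `p`, which has
not decided and has the lap counter `U`. -/
structure Clean (st : ℕ → Fin n → LocalState m b)
    (val : ℕ → Fin b → (Fin m → ℕ) × Option (Fin n)) (p : Fin n) (U : Fin m → ℕ) (s : ℕ) :
    Prop where
  decision : (st s p).decision = none
  lap : (st s p).lap = U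
  val : ∀ j, val s j = (U, some p)

namespace IsRun

variable {input : Fin n → Fin m} {st : ℕ → Fin n → LocalState m b}
  {val : ℕ → Fin b → (Fin m → ℕ) × Option (Fin n)} (R : IsRun hm hb input st val)
include R

theorem st_succ_of_decision {t : ℕ} {p : Fin n} (h : (st t p).decision ≠ none) :
    st (t + 1) p = st t p := by
  rcases R.succ t with ⟨h', -⟩ | ⟨q, hq, h', -⟩
  · rw [h']
  · rw [h', Function.update_of_ne]
    rintro rfl
    exact h hq

theorem st_of_decision {t t' : ℕ} {p : Fin n} (h : (st t p).decision ≠ none) (ht : t ≤ t') :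
    st t' p = st t p := by
  induction ht with
  | refl => rfl
  | step _ ih => rw [R.st_succ_of_decision (by rwa [ih]), ih]

theorem lap_mono (p : Fin n) : Monotone fun t => (st t p).lap := by
  refine monotone_nat_of_le_succ fun t => ?_
  rcases R.succ t with ⟨h', -⟩ | ⟨q, hq, h', -⟩
  · rw [h']
  · by_cases hp : p = q
    · subst hp
      rw [h', Function.update_self]
      exact le_sup_left.trans (le_localStep_lap _ _ _)
    · rw [h', Function.update_of_ne hp]

/-- A process without conflict has read its own pair from all objects of the current iteration, and
they hold this pair when it starts. -/
theorem exists_start (t : ℕ) (p : Fin n) (hd : (st t p).decision = none)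
    (hc : (st t p).conflict = false) :
    ∃ s ≤ t, (st s p).decision = none ∧ (st s p).lap = (st t p).lap ∧
      (∀ j < (st t p).idx, val s j = ((st t p).lap, some p)) ∧
      ∀ j, (st t p).idx ≤ j → val t j = ((st t p).lap, some p) →
        ∀ u, s ≤ u → u ≤ t → val u j = ((st t p).lap, some p) := by
  have start : ∀ t, (st t p).decision = none → (st t p).idx = ⟨0, hb⟩ →
      ∃ s ≤ t, (st s p).decision = none ∧ (st s p).lap = (st t p).lap ∧
      (∀ j < (st t p).idx, val s j = ((st t p).lap, some p)) ∧
      ∀ j, (st t p).idx ≤ j → val t j = ((st t p).lap, some p) →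
        ∀ u, s ≤ u → u ≤ t → val u j = ((st t p).lap, some p) := by
    intro t hd h0
    refine ⟨t, le_rfl, hd, rfl, fun j hj => ?_, fun j _ hj u h1 h2 => ?_⟩
    · rw [h0] at hj; exact absurd hj (Nat.not_lt_zero _)
    · rwa [le_antisymm h2 h1]
  induction t with
  | zero => exact start 0 hd (by rw [R.st_zero])
  | succ t ih =>
    rcases R.succ t with ⟨h1, h2⟩ | ⟨q, hq, h1, h2⟩
    · rw [h1] at hd hc ⊢
      obtain ⟨s, hs, a, b', c, d⟩ := ih hd hc
      refine ⟨s, Nat.le_succ_of_le hs, a, b', c, fun j hj hv u hu hu' => ?_⟩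
      rcases Nat.le_succ_iff.1 hu' with hu' | rfl
      · exact d j hj (by rwa [h2] at hv) u hu hu'
      · exact hv
    -- Only `p` writes its identifier, and since time `s` it has written only to objects it has
    -- already passed. Hence its pair in an object not yet passed has been there since `s`.
    · by_cases hp : p = q
      · subst hp
        by_cases h0 : (st (t + 1) p).idx = ⟨0, hb⟩
        · exact start _ hd h0
        have hst : st (t + 1) p = localStep hm hb p (st t p) (val t (st t p).idx) := by
          rw [h1, Function.update_self]
        rw [hst] at hc h0 ⊢
        rcases localStep_conflict hc with h | ⟨hlt, hc', hr, hl, hi⟩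
        · exact absurd h h0
        obtain ⟨s, hs, a, b', c, d⟩ := ih hq hc'
        rw [hl, hi]
        refine ⟨s, Nat.le_succ_of_le hs, a, b', fun j hj => ?_, fun j hj hv u hu hu' => ?_⟩
        · by_cases hj' : j = (st t p).idx
          · subst hj'; exact d _ le_rfl hr s le_rfl hs
          · refine c j ?_
            rw [Fin.lt_def] at hj ⊢
            have := Fin.val_ne_of_ne hj'
            simp only at hj
            omega
        · rcases Nat.le_succ_iff.1 hu' with hu' | rfl
          · rw [Fin.le_def] at hj
            simp only at hj
            have hj' : j ≠ (st t p).idx := by rintro rfl; omega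
            refine d j (by rw [Fin.le_def]; omega) ?_ u hu hu'
            rwa [h2, nextVal, Function.update_of_ne hj'] at hv
          · exact hv
      · have hst : st (t + 1) p = st t p := by rw [h1, Function.update_of_ne hp]
        rw [hst] at hd hc ⊢
        obtain ⟨s, hs, a, b', c, d⟩ := ih hd hc
        refine ⟨s, Nat.le_succ_of_le hs, a, b', c, fun j hj hv u hu hu' => ?_⟩
        rcases Nat.le_succ_iff.1 hu' with hu' | rfl
        · refine d j hj ?_ u hu hu'
          by_cases hj' : j = (st t q).idx
          · subst hj'
            rw [h2, nextVal, Function.update_self, Prod.mk.injEq, Option.some_inj] at hv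
            exact absurd hv.2.symm hp
          · rwa [h2, nextVal, Function.update_of_ne hj'] at hv
        · exact hv

/-- The last response shows that the last object held the pair since the start of the iteration.
This object is kept as a witness: until `p` finishes, no other process can be clean. -/
theorem exists_clean {t : ℕ} {p : Fin n} (hd : (st t p).decision = none)
    (hc : Commits p (st t p) (val t (st t p).idx)) :
    ∃ s ≤ t, Clean st val p (st t p).lap s ∧
      ∃ j, ∀ u, s ≤ u → u ≤ t → val u j = ((st t p).lap, some p) := by
  obtain ⟨s, hs, a, b', c, d⟩ := R.exists_start t p hd hc.conflict
  have h := d _ le_rfl hc.response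
  refine ⟨s, hs, ⟨a, b', fun j => ?_⟩, _, h⟩
  by_cases hj : j = (st t p).idx
  · subst hj; exact h s le_rfl hs
  · refine c j ?_
    have := Fin.val_ne_of_ne hj
    have := hc.last
    rw [Fin.lt_def]
    omega

/-- A lap beyond the first one is completed by a process that leads when all objects hold its lap
counter. -/
theorem exists_origin {L : ℕ} (hL : 2 ≤ L) (y : Fin m) (t : ℕ)
    (h : (∃ p, L ≤ (st t p).lap y) ∨ ∃ j, L ≤ (val t j).1 y) :
    ∃ s < t, ∃ p U, Clean st val p U s ∧ leader hm U = y ∧ U y + 1 = L := by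
  induction t with
  | zero =>
    rcases h with ⟨p, h⟩ | ⟨j, h⟩
    · rw [R.st_zero] at h
      simp only [Function.update_apply] at h
      split_ifs at h <;> omega
    · rw [R.val_zero] at h
      simp only at h
      omega
  | succ t ih =>
    -- It suffices to treat the first step that reaches `L`. Swaps and maxima only pass on values
    -- below `L`, so that step increments the leader `y`. Initial counters are at most `1`, hence `2
    -- ≤ L`.
    by_cases h' : (∃ p, L ≤ (st t p).lap y) ∨ ∃ j, L ≤ (val t j).1 y
    · obtain ⟨s, hs, h⟩ := ih h'
      exact ⟨s, Nat.lt_succ_of_lt hs, h⟩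
    rcases R.succ t with ⟨h1, h2⟩ | ⟨q, hq, h1, h2⟩
    · rw [h1, h2] at h
      exact absurd h h'
    push Not at h'
    rcases h with ⟨p, h⟩ | ⟨j, h⟩
    · by_cases hp : p = q
      · subst hp
        rw [h1, Function.update_self] at h
        have hU : ((st t p).lap ⊔ (val t (st t p).idx).1) y < L := max_lt (h'.1 _) (h'.2 _)
        rcases localStep_cases hm hb p (st t p) (val t (st t p).idx) with
          ⟨-, e⟩ | ⟨hc, ⟨-, e, -⟩ | ⟨-, e⟩⟩
        · rw [e] at h; omega
        · rw [e] at h; exact absurd h (not_le.2 (h'.1 p))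
        · rw [e] at h
          have hlt := h'.1 p
          by_cases hy : y = leader hm (st t p).lap
          · subst hy
            rw [Function.update_self] at h
            obtain ⟨s, hs, hcl, -⟩ := R.exists_clean hq hc
            exact ⟨s, Nat.lt_succ_of_le hs, p, _, hcl, rfl, by omega⟩
          · rw [Function.update_of_ne hy] at h
            omega
      · rw [h1, Function.update_of_ne hp] at h
        exact absurd h (not_le.2 (h'.1 p))
    · by_cases hj : j = (st t q).idx
      · subst hj
        rw [h2, nextVal, Function.update_self] at h
        exact absurd h (not_le.2 (h'.1 q))
      · rw [h2, nextVal, Function.update_of_ne hj] at h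
        exact absurd h (not_le.2 (h'.2 j))

/-- The lap counter with which a process decides, and the time at which all objects hold it. -/
theorem exists_of_decision {T : ℕ} {p : Fin n} {x : Fin m} (h : (st T p).decision = some x) :
    ∃ U s, Clean st val p U s ∧ (∀ j, j ≠ x → U j + 2 ≤ U x) ∧ (∀ t, (st t p).lap ≤ U) ∧
      ∃ j, ∀ t, s ≤ t → (st t p).decision ≠ none ∨ val t j = (U, some p) := by
  have hex : ∃ t, (st t p).decision ≠ none := ⟨T, by simp [h]⟩
  classical
  obtain ⟨e, he⟩ : ∃ e, Nat.find hex = e + 1 := by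
    refine Nat.exists_eq_succ_of_ne_zero fun h0 => ?_
    have := Nat.find_spec hex
    rw [h0, R.st_zero] at this
    exact this rfl
  have h1 : (st (e + 1) p).decision ≠ none := he ▸ Nat.find_spec hex
  have h0 : (st e p).decision = none := by
    by_contra h
    have := Nat.find_min' hex h
    omega
  have hx : (st (e + 1) p).decision = some x := by
    rcases le_total T (e + 1) with hT | hT
    · rw [R.st_of_decision (by simp [h]) hT, h]
    · rw [← R.st_of_decision h1 hT, h]
  rcases R.succ e with ⟨e1, -⟩ | ⟨q, hq, e1, -⟩
  · rw [e1] at h1; exact absurd h0 h1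
  by_cases hp : p = q
  · subst hp
    have e2 : st (e + 1) p = localStep hm hb p (st e p) (val e (st e p).idx) := by
      rw [e1, Function.update_self]
    rcases localStep_cases hm hb p (st e p) (val e (st e p).idx) with
      ⟨h, -⟩ | ⟨hc, ⟨hg, hl, hd⟩ | ⟨h, -⟩⟩
    · rw [e2] at h1; exact absurd h h1
    · obtain ⟨s, hs, hcl, j, hj⟩ := R.exists_clean h0 hc
      rw [← e2, hx, Option.some_inj] at hd
      subst hd
      rw [← e2] at hl
      refine ⟨_, s, hcl, hg, fun t => ?_, j, fun t ht => ?_⟩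
      · rw [← hl]
        rcases le_total t (e + 1) with ht | ht
        · exact R.lap_mono p ht
        · rw [R.st_of_decision h1 ht]
      · rcases Nat.lt_or_ge e t with ht' | ht'
        · left
          rwa [R.st_of_decision h1 ht']
        · exact Or.inr (hj t ht ht')
    · rw [e2] at h1; exact absurd h h1
  · rw [e1, Function.update_of_ne hp] at h1
    exact absurd h0 h1

/-! ### Spreading of lap counters and `k`-agreement -/

open Classical in
/-- The number of processes outside `F` and objects with a lap counter that does not dominate `U`
does not increase. -/
theorem card_succ_le (U : Fin m → ℕ) (F : Finset (Fin n)) (t : ℕ)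
    (hF : ∀ p ∈ F, (st t p).decision ≠ none) :
    (Finset.univ.filter fun p => p ∉ F ∧ ¬ U ≤ (st (t + 1) p).lap).card +
      (Finset.univ.filter fun j => ¬ U ≤ (val (t + 1) j).1).card ≤
    (Finset.univ.filter fun p => p ∉ F ∧ ¬ U ≤ (st t p).lap).card +
      (Finset.univ.filter fun j => ¬ U ≤ (val t j).1).card := by
  have sub : (Finset.univ.filter fun p => p ∉ F ∧ ¬ U ≤ (st (t + 1) p).lap) ⊆
      Finset.univ.filter fun p => p ∉ F ∧ ¬ U ≤ (st t p).lap := by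
    intro p
    simp only [Finset.mem_filter, Finset.mem_univ, true_and]
    exact fun h => ⟨h.1, fun h' => h.2 (h'.trans (R.lap_mono p (Nat.le_succ t)))⟩
  rcases R.succ t with ⟨-, h2⟩ | ⟨q, hq, h1, h2⟩
  · rw [h2]
    exact Nat.add_le_add_right (Finset.card_le_card sub) _
  have hqF : q ∉ F := fun h => hF q h hq
  -- In the first case the swap creates no new object lacking `U`. In the other case one object may
  -- lose `U`, but `q` learns it.
  by_cases ho : U ≤ (st t q).lap ∨ ¬ U ≤ (val t (st t q).idx).1
  · refine Nat.add_le_add (Finset.card_le_card sub) (Finset.card_le_card fun j => ?_)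
    simp only [Finset.mem_filter, Finset.mem_univ, true_and]
    intro hj
    by_cases hj' : j = (st t q).idx
    · subst hj'
      rw [h2, nextVal, Function.update_self] at hj
      exact ho.resolve_left hj
    · rwa [h2, nextVal, Function.update_of_ne hj'] at hj
  · push Not at ho
    have hmem : q ∈ Finset.univ.filter fun p => p ∉ F ∧ ¬ U ≤ (st t p).lap := by
      simp [hqF, ho.1]
    have c1 : (Finset.univ.filter fun p => p ∉ F ∧ ¬ U ≤ (st (t + 1) p).lap) ⊆
        (Finset.univ.filter fun p => p ∉ F ∧ ¬ U ≤ (st t p).lap).erase q := by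
      refine Finset.subset_erase.2 ⟨sub, ?_⟩
      simp only [Finset.mem_filter, Finset.mem_univ, true_and, not_and, not_not]
      intro _
      rw [h1, Function.update_self]
      exact ho.2.trans (le_sup_right.trans (le_localStep_lap _ _ _))
    have c2 : (Finset.univ.filter fun j => ¬ U ≤ (val (t + 1) j).1) ⊆
        insert (st t q).idx (Finset.univ.filter fun j => ¬ U ≤ (val t j).1) := by
      intro j
      simp only [Finset.mem_insert, Finset.mem_filter, Finset.mem_univ, true_and]
      intro hj
      by_cases hj' : j = (st t q).idx
      · exact Or.inl hj'
      · rw [h2, nextVal, Function.update_of_ne hj'] at hj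
        exact Or.inr hj
    have := Finset.card_le_card c1
    have := (Finset.card_le_card c2).trans (Finset.card_insert_le _ _)
    have := Finset.card_erase_add_one hmem
    omega

open Classical in
theorem card_le (U : Fin m → ℕ) (F : Finset (Fin n)) {s t : ℕ} (hst : s ≤ t)
    (hF : ∀ p ∈ F, (st s p).decision ≠ none) :
    (Finset.univ.filter fun p => p ∉ F ∧ ¬ U ≤ (st t p).lap).card +
      (Finset.univ.filter fun j => ¬ U ≤ (val t j).1).card ≤
    (Finset.univ.filter fun p => p ∉ F ∧ ¬ U ≤ (st s p).lap).card +
      (Finset.univ.filter fun j => ¬ U ≤ (val s j).1).card := by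
  induction hst with
  | refl => exact le_rfl
  | @step t hst ih =>
    exact (R.card_succ_le U F t fun p hp => by
      rw [R.st_of_decision (hF p hp) hst]; exact hF p hp).trans ih

open Classical in
/-- If at some time all objects held `U` and later all objects hold a lap counter that does not
dominate `U`, then few processes that were active do not know about `U`. -/
theorem exists_informed (hk : k + b = n) {q : Fin n} {U W : Fin m → ℕ} {s s' : ℕ}
    (hq : Clean st val q U s) (hs : s ≤ s') (hW : ∀ j, (val s' j).1 = W) (hUW : ¬ U ≤ W)
    (Q : Finset (Fin n)) (hQ : k ≤ Q.card) :
    ∃ r ∈ Q, (st s r).decision = none ∧ U ≤ (st s' r).lap := by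
  by_contra hcon
  push Not at hcon
  set F : Finset (Fin n) := Finset.univ.filter fun p => (st s p).decision ≠ none
  have hFd : ∀ p ∈ F, (st s p).decision ≠ none := by simp [F]
  -- At time `s` no object and at most `n - |F| - 1` processes outside `F` lack `U`. At time `s'`
  -- all `b = n - k` objects lack it, which leaves at most `k - |F| - 1` such processes, fewer than
  -- `Q \ F` has.
  have key := R.card_le U F hs hFd
  have a1 : (Finset.univ.filter fun j => ¬ U ≤ (val s' j).1) = Finset.univ := by
    simp [hW, hUW]
  have a2 : (Finset.univ.filter fun j => ¬ U ≤ (val s j).1) = ∅ := by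
    simp [hq.val]
  have a3 : Q \ F ⊆ Finset.univ.filter fun p => p ∉ F ∧ ¬ U ≤ (st s' p).lap := by
    intro r
    simp only [Finset.mem_sdiff, Finset.mem_filter, Finset.mem_univ, true_and, F, not_not]
    exact fun h => ⟨h.2, hcon r h.1 h.2⟩
  have a4 : (Finset.univ.filter fun p => p ∉ F ∧ ¬ U ≤ (st s p).lap) ⊆
      (Finset.univ \ F).erase q := by
    intro r
    simp only [Finset.mem_erase, Finset.mem_sdiff, Finset.mem_filter, Finset.mem_univ, true_and]
    refine fun h => ⟨?_, h.1⟩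
    rintro rfl
    exact h.2 hq.lap.ge
  have hqF : q ∈ Finset.univ \ F := by simp [F, hq.decision]
  have b3 := Finset.card_le_card a3
  have b4 := Finset.card_le_card a4
  have b5 := Finset.card_erase_add_one hqF
  have b6 := Finset.card_sdiff_add_card_eq_card (Finset.subset_univ F)
  have b7 := Finset.le_card_sdiff F Q
  rw [Finset.card_univ, Fintype.card_fin] at b6
  rw [a1, a2, Finset.card_univ, Fintype.card_fin, Finset.card_empty] at key
  omega

theorem card_le_of_decision (hk : k + b = n) (hk1 : 1 ≤ k) (T : ℕ) (X : Finset (Fin m))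
    (hX : ∀ x ∈ X, ∃ p, (st T p).decision = some x) : X.card ≤ k := by
  by_contra hcard
  push Not at hcard
  obtain ⟨x₀, hx₀⟩ := Finset.card_pos.1 (by omega : 0 < X.card)
  have : Nonempty (Fin n) := ⟨(hX x₀ hx₀).choose⟩
  choose! P hP using hX
  have hPinj : Set.InjOn P X := by
    intro x hx x' hx' h
    have := hP x hx
    rw [h, hP x' hx', Option.some_inj] at this
    exact this.symm
  choose! U S hcl hgap hmax B hB using fun x hx => R.exists_of_decision (hP x hx)
  -- processes that decide at a time when another process is clean
  have hid : ∀ x ∈ X, ∀ q W s, Clean st val q W s → S x ≤ s →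
      (st s (P x)).decision ≠ none ∨ U x = W ∧ P x = q := by
    intro x hx q W s hc hs
    refine (hB x hx s hs).imp_right fun h => ?_
    rw [hc.val, Prod.mk.injEq, Option.some_inj] at h
    exact ⟨h.1.symm, h.2.symm⟩
  -- Until `P x` decides, the object `B x` keeps its pair, so `P x'` cannot be clean.
  have hdec : ∀ x ∈ X, ∀ x' ∈ X, x ≠ x' → S x ≤ S x' → (st (S x') (P x)).decision ≠ none := by
    intro x hx x' hx' hne hs
    exact (hid x hx _ _ _ (hcl x' hx') hs).resolve_right fun h => hne (hPinj hx hx' h.2)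
  -- Counters of finished deciders reach every later clean process. Induction goes from late to
  -- early clean times: if `U x` is not below `W`, then among `q` and the other deciders one active
  -- at `S x` has learned `U x`; it is `q`, or a decider with a later clean time, to which the
  -- induction hypothesis applies.
  have trans : ∀ Y ⊆ X, k ≤ Y.card → ∀ q W s', Clean st val q W s' →
      (∀ x ∈ Y, (st s' (P x)).decision ≠ none) → ∀ x ∈ Y, U x ≤ W := by
    intro Y hY hYk q W s' hc hYd x hx
    obtain ⟨d, hd⟩ : ∃ d, s' - S x = d := ⟨_, rfl⟩
    induction d using Nat.strong_induction_on generalizing x with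
    | _ d ih =>
      by_contra hUW
      have hlt : ∀ x ∈ Y, S x < s' := by
        intro x hx
        by_contra hle
        have h := hYd x hx
        rw [← R.st_of_decision h (not_lt.1 hle)] at h
        exact h (hcl x (hY hx)).decision
      have hq : q ∉ (Y.erase x).image P := by
        rw [Finset.mem_image]
        rintro ⟨x', hx', rfl⟩
        exact hYd x' (Finset.mem_of_mem_erase hx') hc.decision
      have hcardQ : k ≤ (insert q ((Y.erase x).image P)).card := by
        rw [Finset.card_insert_of_notMem hq, Finset.card_image_of_injOn
          (hPinj.mono ((Finset.coe_subset.2 (Finset.erase_subset x Y)).trans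
            (Finset.coe_subset.2 hY))), Finset.card_erase_add_one hx]
        exact hYk
      obtain ⟨r, hr, hr1, hr2⟩ := R.exists_informed hk (hcl x (hY hx)) (hlt x hx).le
        (fun j => by rw [hc.val]) hUW _ hcardQ
      rw [Finset.mem_insert, Finset.mem_image] at hr
      rcases hr with rfl | ⟨x', hx', rfl⟩
      · rw [hc.lap] at hr2
        exact hUW hr2
      · rw [Finset.mem_erase] at hx'
        have hS : S x < S x' := by
          by_contra hS
          exact hdec x' (hY hx'.2) x (hY hx) hx'.1 (not_lt.1 hS) hr1
        have := hlt x hx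
        exact hUW ((hr2.trans (hmax x' (hY hx'.2) s')).trans
          (ih _ (by omega) x' hx'.2 rfl))
  obtain ⟨y, hy, hyS⟩ := X.exists_max_image S (Finset.card_pos.1 (by omega))
  have hYcard : k ≤ (X.erase y).card := by
    rw [Finset.card_erase_of_mem hy]; omega
  have hYX := Finset.erase_subset y X
  have hYne : (X.erase y).Nonempty := Finset.card_pos.1 (by omega)
  have hUy := trans _ hYX hYcard _ _ _ (hcl y hy) fun x hx =>
    hdec x (hYX hx) y hy (Finset.ne_of_mem_erase hx) (hyS x (hYX hx))
  obtain ⟨z, hz, hzmax⟩ := (X.erase y).exists_max_image (fun x => U x x) hYne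
  have hzy := Finset.ne_of_mem_erase hz
  have h1 := hgap z (hYX hz) y hzy.symm
  have h2 := hgap y hy z hzy
  have h3 : U z z ≤ U y z := hUy z hz z
  -- The gap at `z` gives `2 ≤ U z z`, and `U y y ≥ U y z + 2 ≥ U z z + 2`, so value `y` did
  -- complete lap `U z z`.
  obtain ⟨s, hs, q, W, hW, hWy, hWL⟩ := R.exists_origin (L := U z z) (by omega) y (S y)
    (Or.inl ⟨P y, by rw [(hcl y hy).lap]; omega⟩)
  -- no other decided lap counter dominates `W`
  have hno : ∀ x ∈ X.erase y, ¬ W ≤ U x := by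
    intro x hx h
    have : W y ≤ U x y := h y
    have : U x x ≤ U z z := hzmax x hx
    have := hgap x (hYX hx) y (Finset.ne_of_mem_erase hx).symm
    omega
  obtain ⟨w, hw, hwS⟩ := (X.erase y).exists_max_image S hYne
  -- Either `W` is displaced by `U w` and a decider learns `W`, or all these deciders have finished
  -- before `W` is clean and `U z ≤ W`.
  rcases le_or_gt s (S w) with hsw | hsw
  · obtain ⟨r, hr, -, hr2⟩ := R.exists_informed hk hW hsw
      (fun j => by rw [(hcl w (hYX hw)).val]) (hno w hw) ((X.erase y).image P) (by
        rwa [Finset.card_image_of_injOn (hPinj.mono (Finset.coe_subset.2 hYX))])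
    obtain ⟨x, hx, rfl⟩ := Finset.mem_image.1 hr
    exact hno x hx (hr2.trans (hmax x (hYX hx) _))
  · have : U z z ≤ W z := trans _ hYX hYcard _ _ _ hW (fun x hx =>
      (hid x (hYX hx) _ _ _ hW ((hwS x hx).trans hsw.le)).resolve_right
        fun h => hno x hx h.1.ge) z hz z
    have := le_leader hm W z
    rw [hWy] at this
    omega

/-! ### Validity -/

/-- Every lap is one of an input value, and every process has completed a lap of its input. -/
theorem lap_pos (t : ℕ) : (∀ p y, 0 < (st t p).lap y → ∃ q, input q = y) ∧
    (∀ j y, 0 < (val t j).1 y → ∃ q, input q = y) ∧ ∀ p, 0 < (st t p).lap (input p) := by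
  induction t with
  | zero =>
    refine ⟨fun p y h => ⟨p, ?_⟩, fun j y h => ?_, fun p => ?_⟩
    · rw [R.st_zero] at h
      by_contra hne
      simp [Ne.symm hne] at h
    · rw [R.val_zero] at h
      exact absurd h (lt_irrefl _)
    · rw [R.st_zero]
      simp
  | succ t ih =>
    obtain ⟨i1, i2, i3⟩ := ih
    refine ⟨?_, ?_, fun p => (i3 p).trans_le (R.lap_mono p (Nat.le_succ t) _)⟩
    all_goals rcases R.succ t with ⟨h1, h2⟩ | ⟨q, hq, h1, h2⟩
    · rwa [h1]
    · intro p y h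
      by_cases hp : p = q
      · subst hp
        rw [h1, Function.update_self] at h
        rcases localStep_cases hm hb p (st t p) (val t (st t p).idx) with
          ⟨-, e⟩ | ⟨hc, ⟨-, e, -⟩ | ⟨-, e⟩⟩ <;> rw [e] at h
        · rcases lt_max_iff.1 h with h | h
          · exact i1 p y h
          · exact i2 _ y h
        · exact i1 p y h
        -- The leader's component is positive because it is at least that of the process's own
        -- input.
        · by_cases hy : y = leader hm (st t p).lap
          · subst hy
            exact i1 p _ ((i3 p).trans_le (le_leader hm _ _))
          · rw [Function.update_of_ne hy] at h
            exact i1 p y h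
      · rw [h1, Function.update_of_ne hp] at h
        exact i1 p y h
    · rwa [h2]
    · intro j y h
      by_cases hj : j = (st t q).idx
      · subst hj
        rw [h2, nextVal, Function.update_self] at h
        exact i1 q y h
      · rw [h2, nextVal, Function.update_of_ne hj] at h
        exact i2 j y h

theorem exists_input_of_decision {T : ℕ} {p : Fin n} {x : Fin m}
    (h : (st T p).decision = some x) : ∃ q, input q = x := by
  by_cases hx : input p = x
  · exact ⟨p, hx⟩
  -- The lead of `x` over the different value `input p` makes `U x` positive.
  obtain ⟨U, s, hcl, hg, -, -⟩ := R.exists_of_decision h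
  refine (R.lap_pos s).1 p x ?_
  have := hg _ hx
  rw [hcl.lap]
  omega

end IsRun

end Run

/-! ### From runs back to executions of `setAgreeSwap` -/

section Transfer

variable {k : ℕ} {hkn : k < n}

theorem action_of_none {p : Fin n} {s : LocalState m (n - k)} (h : s.decision = none) :
    (setAgreeSwap n m k hm hkn).action p s = SwapAction.swap s.idx (s.lap, some p) := by
  simp [setAgreeSwap, h]

theorem action_of_some {p : Fin n} {s : LocalState m (n - k)} {x : Fin m}
    (h : s.decision = some x) :
    (setAgreeSwap n m k hm hkn).action p s = SwapAction.decided x := by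
  simp [setAgreeSwap, h]

theorem decided_iff {C : (setAgreeSwap n m k hm hkn).Config} {p : Fin n} {x : Fin m} :
    (setAgreeSwap n m k hm hkn).Decided C p x ↔
      LocalState.decision (b := n - k) (C.state p) = some x := by
  rcases h : LocalState.decision (b := n - k) (C.state p) with _ | y
  · simp [SwapAlgorithm.Decided, action_of_none h]
  · simp [SwapAlgorithm.Decided, action_of_some h]

theorem step_iff {p : Fin n} {C C' : (setAgreeSwap n m k hm hkn).Config} :
    (setAgreeSwap n m k hm hkn).Step p C C' ↔
      ∃ s : LocalState m (n - k), s = C.state p ∧ s.decision = none ∧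
      C' = ⟨Function.update C.state p
        (localStep hm (Nat.sub_pos_of_lt hkn) p s (C.val s.idx)), nextVal p s C.val⟩ := by
  constructor
  · rintro ⟨B, w, ha, s, hs, rfl⟩
    rcases h : LocalState.decision (b := n - k) (C.state p) with _ | y
    · obtain ⟨rfl, rfl⟩ := SwapAction.swap.inj ((action_of_none h).symm.trans ha)
      obtain rfl := Set.mem_singleton_iff.1 hs
      exact ⟨C.state p, rfl, h, rfl⟩
    · rw [action_of_some h] at ha
      cases ha
  · rintro ⟨s, rfl, hd, rfl⟩
    exact ⟨_, _, action_of_none hd, _, rfl, rfl⟩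

/-- Time runs over all of `ℕ`: after its last step the execution is continued by pauses. -/
theorem exists_run {C C' : (setAgreeSwap n m k hm hkn).Config} {h : List (Fin n)}
    (e : (setAgreeSwap n m k hm hkn).Exec C h C') :
    ∃ (st : ℕ → Fin n → LocalState m (n - k))
      (val : ℕ → Fin (n - k) → (Fin m → ℕ) × Option (Fin n)) (T : ℕ),
      st 0 = C.state ∧ val 0 = C.val ∧ st T = C'.state ∧
      ∀ t, (st (t + 1) = st t ∧ val (t + 1) = val t) ∨ ∃ p, (st t p).decision = none ∧
        st (t + 1) = Function.update (st t) p
          (localStep hm (Nat.sub_pos_of_lt hkn) p (st t p) (val t (st t p).idx)) ∧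
        val (t + 1) = nextVal p (st t p) (val t) := by
  induction e with
  | nil C => exact ⟨fun _ => C.state, fun _ => C.val, 0, rfl, rfl, rfl, fun _ => Or.inl ⟨rfl, rfl⟩⟩
  | @cons C C₁ C₂ p h hs _ ih =>
    obtain ⟨st, val, T, h0, h0', hT, hst⟩ := ih
    obtain ⟨s, rfl, hd, rfl⟩ := step_iff.1 hs
    refine ⟨fun t => Nat.casesOn t C.state st, fun t => Nat.casesOn t C.val val, T + 1, rfl, rfl,
      hT, fun t => ?_⟩
    cases t with
    | zero => exact Or.inr ⟨p, hd, h0, h0'⟩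
    | succ t => exact hst t

theorem exists_isRun {input : Fin n → Fin m} {C : (setAgreeSwap n m k hm hkn).Config}
    {h : List (Fin n)}
    (e : (setAgreeSwap n m k hm hkn).Exec ((setAgreeSwap n m k hm hkn).initConfig input) h C) :
    ∃ st val T, IsRun hm (Nat.sub_pos_of_lt hkn) input st val ∧ st T = C.state := by
  obtain ⟨st, val, T, h0, h0', hT, hst⟩ := exists_run e
  exact ⟨st, val, T, ⟨fun p => congrFun h0 p, fun j => congrFun h0' j, hst⟩, hT⟩

theorem kAgreement (hk : 1 ≤ k) : (setAgreeSwap n m k hm hkn).KAgreement k := by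
  intro input h C e
  obtain ⟨st, val, T, R, hT⟩ := exists_isRun e
  rw [Set.ncard_eq_toFinset_card _ (Set.toFinite _)]
  refine R.card_le_of_decision (by omega) hk T _ fun x hx => ?_
  obtain ⟨p, hp⟩ := (Set.Finite.mem_toFinset _).1 hx
  exact ⟨p, by rw [hT]; exact decided_iff.1 hp⟩

theorem validity : (setAgreeSwap n m k hm hkn).Validity := by
  intro input h C e p x hp
  obtain ⟨st, val, T, R, hT⟩ := exists_isRun e
  exact R.exists_input_of_decision (T := T) (p := p) (by rw [hT]; exact decided_iff.1 hp)

theorem runsFor_of_exec {p : Fin n} {C C' : (setAgreeSwap n m k hm hkn).Config}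
    {h : List (Fin n)} (e : (setAgreeSwap n m k hm hkn).Exec C h C') (hp : ∀ q ∈ h, q = p) :
    RunsFor hm (Nat.sub_pos_of_lt hkn) p h.length (C.state p) C.val := by
  induction e with
  | nil => exact trivial
  | @cons C C₁ C₂ q h hs _ ih =>
    obtain rfl : q = p := hp q (by simp)
    obtain ⟨s, rfl, hd, rfl⟩ := step_iff.1 hs
    have := ih fun r hr => hp r (by simp [hr])
    exact ⟨hd, Eq.mp (congrArg
      (fun s => RunsFor hm (Nat.sub_pos_of_lt hkn) q h.length s (nextVal q (C.state q) C.val))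
      (Function.update_self (β := fun _ => LocalState m (n - k)) q _ C.state)) this⟩

theorem length_le {p : Fin n} {C C' : (setAgreeSwap n m k hm hkn).Config}
    {h : List (Fin n)} (e : (setAgreeSwap n m k hm hkn).Exec C h C') (hp : ∀ q ∈ h, q = p) :
    h.length ≤ 8 * (n - k) :=
  bounded_eight _ _ _ (runsFor_of_exec e hp)

theorem exists_solo (C : (setAgreeSwap n m k hm hkn).Config) (p : Fin n) (l : ℕ) :
    ∃ h C', (∀ q ∈ h, q = p) ∧ (setAgreeSwap n m k hm hkn).Exec C h C' ∧
      (h.length = l ∨ ∃ x, (setAgreeSwap n m k hm hkn).Decided C' p x) := by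
  induction l generalizing C with
  | zero => exact ⟨[], C, by simp, SwapAlgorithm.Exec.nil C, Or.inl rfl⟩
  | succ l ih =>
    rcases hd : LocalState.decision (b := n - k) (C.state p) with _ | x
    · obtain ⟨h, C', hp, e, hl⟩ := ih _
      exact ⟨p :: h, C', by simpa using hp,
        SwapAlgorithm.Exec.cons (step_iff.2 ⟨_, rfl, hd, rfl⟩) e, hl.imp_left (by simp [·])⟩
    · exact ⟨[], C, by simp, SwapAlgorithm.Exec.nil C, Or.inr ⟨x, decided_iff.2 hd⟩⟩

theorem obstructionFree : (setAgreeSwap n m k hm hkn).ObstructionFree := by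
  refine ⟨fun p s _ _ _ r => ⟨_, rfl⟩, fun C _ p => ?_⟩
  -- One step more than any solo execution can have, so the alternative, a decision, must hold.
  obtain ⟨h, C', hp, e, hl⟩ := exists_solo C p (8 * (n - k) + 1)
  refine ⟨h, C', hp, e, hl.resolve_left fun hl => ?_⟩
  have := length_le e hp
  omega

end Transfer

end SetAgreeSwap

theorem mainTheorem2 (n m k : ℕ) (hm : 0 < m) (hk : 1 ≤ k) (hkn : k < n) :
    -- the algorithm, which uses `n - k` swap objects, solves `m`-valued `k`-set agreement
    (setAgreeSwap n m k hm hkn).KAgreement k ∧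
    (setAgreeSwap n m k hm hkn).Validity ∧
    (setAgreeSwap n m k hm hkn).ObstructionFree ∧
    -- every solo execution from any configuration has at most `8 (n - k)` steps
    (∀ (C C' : (setAgreeSwap n m k hm hkn).Config) (p : Fin n) (h : List (Fin n)),
      (∀ q ∈ h, q = p) → (setAgreeSwap n m k hm hkn).Exec C h C' → h.length ≤ 8 * (n - k)) ∧
    -- for `k = 1` the number of objects is optimal
    (k = 1 → 2 ≤ m → ∀ (b : ℕ) (A : SwapAlgorithm.{u, v} n m b),
      A.IsSetAgreement 1 → A.NondetSoloTerminating → n - 1 ≤ b) := by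
  refine ⟨SetAgreeSwap.kAgreement hk, SetAgreeSwap.validity, SetAgreeSwap.obstructionFree,
    fun _ _ _ _ hp e => SetAgreeSwap.length_le e hp, ?_⟩
  rintro - h2 b A hA hN
  exact SwapAlgorithm.sub_one_le_of_consensus (by omega) h2 hA hN
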